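/- Let $\mathcal Z^2=\{(x_1,x_2)\in\mathbb Z^2: x_1+x_2 \text{ even}\}$. Let $p\colon\mathbb R^2\to(0,1]$ be continuous, Lipschitz in its second argument uniformly in the first, with $p\ge p_{\min}$ for some $p_{\min}>0$, and vertically homogeneous, that is, $p(x_1,x_2)=p(x_1)$ does not depend on $x_2$. For a scaling parameter $m>0$ let $\{\zeta_x\}_{x\in\mathcal Z^2}$ and $\{\xi_x\}_{x\in\mathcal Z^2}$ be independent random variables, with $\zeta_x$ Bernoulli with parameter $p(x/m^2)$ and $\xi_x$ Bernoulli with parameter $1/2$. The node $x$ is occupied if $\zeta_x=1$. From every occupied node $x=(x_1,x_2)$ draw a directed edge to the occupied node $(x_1-1,y)$ with $|x_2-y|$ minimal; if there are two such nodes, take the upper one if $\xi_x=1$ and the lower one if $\xi_x=0$. Let $\tau_m(x)$ be the number of points in the longest directed path of occupied nodes whose last (leftmost) point lies in the slit $\{x_1\}\times[x_2-m/2,x_2+m/2]$ (this is the longest path that carries traffic through the slit; $\tau_m(x)=0$ if the slit contains no occupied node). Then there is $C<\infty$ such that, for every real $\alpha>2$ and every real $\ell\ge1$, $$\sup_{x\in\mathcal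 Z^2}\mathbb P\big(\tau_{\ell^{1/\alpha}}(x)\ge \ell\big)<C\,\ell^{1/\alpha-1/2}.$$ Equivalently (replacing $\ell$ by $\ell^\alpha$), $\sup_{x}\mathbb P(\tau_\ell(x)\ge\ell^\alpha)<C\,\ell^{1-\alpha/2}$. -/

import Mathlib

open MeasureTheory ProbabilityTheory
open scoped ENNReal NNReal unitInterval

namespace DilutedLattice

/-- The nodes of the even planar lattice `{(x₁, x₂) ∈ ℤ² : x₁ + x₂ even}`. -/
abbrev Node : Type := {x : ℤ × ℤ // Even (x.1 + x.2)}

/-- A thinning field `p : ℝ² → (0, 1]`: continuous, Lipschitz in the second argument (uniformly in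
the first one), and bounded away from zero. -/
structure ThinningField where
  /-- the underlying function of two real variables -/
  toFun : ℝ × ℝ → ℝ
  continuous_toFun : Continuous toFun
  lipschitz_snd : ∃ Ξ : ℝ≥0, 0 < Ξ ∧ ∀ s : ℝ, LipschitzWith Ξ (fun t : ℝ => toFun (s, t))
  bounded_below : ∃ pmin : ℝ, 0 < pmin ∧ ∀ z, pmin ≤ toFun z
  le_one : ∀ z, toFun z ≤ 1

/-- `p` depends on the horizontal coordinate only. -/
def ThinningField.VerticallyHomogeneous (p : ThinningField) : Prop :=
  ∀ s t t' : ℝ, p.toFun (s, t) = p.toFun (s, t')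

/-- The occupation probability `p_ℓ(x) = p(x / ℓ²)` of the node `x`, as a point of `[0, 1]`. -/
noncomputable def ThinningField.prob (p : ThinningField) (ℓ : ℝ) (x : Node) : I :=
  ⟨p.toFun ((x.1.1 : ℝ) / ℓ ^ 2, (x.1.2 : ℝ) / ℓ ^ 2), by
    obtain ⟨c, hc, h⟩ := p.bounded_below
    exact ⟨hc.le.trans (h _), p.le_one _⟩⟩

/-- The fair success probability `1/2`. -/
noncomputable def half : I := ⟨1 / 2, by norm_num, by norm_num⟩

/-- A configuration attaches to every node `x` the pair `(ζ_x, ξ_x)`: `ζ_x` says whether `x` is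
occupied, and `ξ_x` is the tie-breaking choice (`true` is up, `false` is down). -/
abbrev Config : Type := Node → Bool × Bool

/-- The law of the model with scaling parameter `ℓ`: all the variables `ζ_x`, `ξ_x` are
independent, `ζ_x` is Bernoulli with parameter `p_ℓ(x)` and `ξ_x` is Bernoulli with parameter
`1/2`. -/
noncomputable def ThinningField.law (p : ThinningField) (ℓ : ℝ) : Measure Config :=
  Measure.infinitePi fun x : Node =>
    (bernoulliMeasure true false (p.prob ℓ x)).prod (bernoulliMeasure true false half)

/-- The node `x` is occupied. -/
def Occupied (ω : Config) (x : Node) : Prop := (ω x).1 = true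

/-- `y` is an occupied node of the layer directly to the left of `x`, and no occupied node of that
layer is vertically closer to `x`. -/
def IsNearest (ω : Config) (x y : Node) : Prop :=
  y.1.1 = x.1.1 - 1 ∧ Occupied ω y ∧
    ∀ z : Node, z.1.1 = x.1.1 - 1 → Occupied ω z → |x.1.2 - y.1.2| ≤ |x.1.2 - z.1.2|

/-- There is a directed edge from the occupied node `x` to `y`: either `y` is the only nearest
occupied node in the layer to the left of `x`, or there are two of them (one above `x`, one below
it, at the same distance) and `y` is the upper one if `ξ_x = 1` and the lower one if `ξ_x = 0`. -/
def Edge (ω : Config) (x y : Node) : Prop :=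
  Occupied ω x ∧ IsNearest ω x y ∧
    ∀ z : Node, IsNearest ω x z → z ≠ y →
      if (ω x).2 = true then z.1.2 < y.1.2 else y.1.2 < z.1.2

/-- The nodes in the slit `{x₁} × [x₂ - ℓ/2, x₂ + ℓ/2]`. -/
def slit (ℓ : ℝ) (x : Node) : Set Node :=
  {y | y.1.1 = x.1.1 ∧ (y.1.2 : ℝ) ∈ Set.Icc ((x.1.2 : ℝ) - ℓ / 2) ((x.1.2 : ℝ) + ℓ / 2)}

/-- `γ 0, …, γ (n - 1)` are the points of a directed path of occupied nodes, listed against the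
direction of the edges, whose leftmost point `γ 0` lies in the slit. The traffic of all these
points flows along the path into the slit. -/
def IsPathThroughSlit (ω : Config) (ℓ : ℝ) (x : Node) (n : ℕ) (γ : ℕ → Node) : Prop :=
  (∀ i < n, Occupied ω (γ i)) ∧ (∀ i, i + 1 < n → Edge ω (γ (i + 1)) (γ i)) ∧
    (0 < n → γ 0 ∈ slit ℓ x)

/-- The number of points in the longest path that carries traffic through the slit of width `ℓ`
around `x` (zero if the slit contains no occupied node, `⊤` if there are arbitrarily long such
paths). -/
noncomputable def tau (ω : Config) (ℓ : ℝ) (x : Node) : ℕ∞ :=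
  ⨆ (n : ℕ) (_ : ∃ γ : ℕ → Node, IsPathThroughSlit ω ℓ x n γ), (n : ℕ∞)

/-- The probability, in the model with scaling parameter `ℓ`, that the longest path through the
slit of width `ℓ` around `x` has at least `t` points. -/
noncomputable def ThinningField.tauTail (p : ThinningField) (ℓ : ℝ) (x : Node) (t : ℝ) : ℝ≥0∞ :=
  p.law ℓ {ω | ENNReal.ofReal t ≤ ((tau ω ℓ x : ℕ∞) : ℝ≥0∞)}

end DilutedLattice

/-! Explore backwards from the slit, one layer to the right at a time: `ancestors` collects the
nodes whose chain of selections leads into it. `Selects` drops the requirement that the selecting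
node be occupied, which only enlarges these sets. A path with more than `n` points forces survival
for `n` steps, so the task is an extinction estimate in the style of critical branching processes.

Each step uses fresh randomness (`ancestors_succ_resample`). The population size has nonpositive
drift: by vertical translation invariance, the expected number of nodes selecting `y` equals the
expected number of nodes in the layer of `y` selected by one fixed node, at most 1
(`tsum_law_selects_le_one`). Nor can it stand still: if `p ≥ c > 0`, the size of a nonempty set
changes with probability at least `c ^ 2 / 2` (`le_law_card_step_ne`). Hence `exp (-l * card)` grows
in mean by a factor at least `1 + c ^ 2 * l ^ 2 / 8` from a nonempty set
(`le_integral_expWeight_step`). Its mean starts above `1 - l * card S` and never exceeds 1; with `l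
= 1 / √n`, adding the gains over `n` steps bounds survival by a constant times `card S / √n`
(`survival_le`). A slit of width `m ≥ 1` holds at most `2 * m` nodes. -/

/-! ### Product measures and fair coins. -/

/-- Resampling the coordinates outside a set does not change a product measure. -/
theorem infinitePi_map_piecewise {ι : Type*} {X : ι → Type*} {mX : ∀ i, MeasurableSpace (X i)}
    (μ : (i : ι) → Measure (X i)) [∀ i, IsProbabilityMeasure (μ i)] (A : Set ι)
    [∀ i, Decidable (i ∈ A)] :
    ((Measure.infinitePi μ).prod (Measure.infinitePi μ)).map
      (fun q : (∀ i, X i) × (∀ i, X i) => A.piecewise q.1 q.2) = Measure.infinitePi μ := by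
  have hm : Measurable (fun q : (∀ i, X i) × (∀ i, X i) => A.piecewise q.1 q.2) := by
    refine measurable_pi_iff.2 fun i => ?_
    by_cases hi : i ∈ A
    · simp only [Set.piecewise, hi, if_true]; fun_prop
    · simp only [Set.piecewise, hi, if_false]; fun_prop
  refine Measure.eq_infinitePi μ fun s t ht => ?_
  rw [Measure.map_apply hm (.pi s.countable_toSet fun _ _ => ht _)]
  have : (fun q : (∀ i, X i) × (∀ i, X i) => A.piecewise q.1 q.2) ⁻¹' ((s : Set ι).pi t) =
      ((s.filter (· ∈ A) : Finset ι) : Set ι).pi t ×ˢ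
        ((s.filter (· ∉ A) : Finset ι) : Set ι).pi t := by
    ext q
    simp only [Set.mem_preimage, Set.mem_pi, Set.mem_prod, Finset.mem_coe, Finset.mem_filter]
    constructor
    · intro h
      refine ⟨fun i hi => ?_, fun i hi => ?_⟩
      · simpa [Set.piecewise, hi.2] using h i hi.1
      · simpa [Set.piecewise, hi.2] using h i hi.1
    · rintro ⟨h1, h2⟩ i hi
      by_cases hA : i ∈ A
      · simpa [Set.piecewise, hA] using h1 i ⟨hi, hA⟩
      · simpa [Set.piecewise, hA] using h2 i ⟨hi, hA⟩
  rw [this, Measure.prod_prod, Measure.infinitePi_pi _ fun i _ => ht i,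
    Measure.infinitePi_pi _ fun i _ => ht i, Finset.prod_filter_mul_prod_filter_not]

/-- A fair coin is invariant under negation. -/
theorem map_not_bernoulliMeasure_half :
    (bernoulliMeasure true false DilutedLattice.half).map not =
      bernoulliMeasure true false DilutedLattice.half := by
  have h : unitInterval.symm DilutedLattice.half = DilutedLattice.half := by
    ext; simp [DilutedLattice.half]; norm_num
  rw [bernoulliMeasure_def, Measure.map_add _ _ (by fun_prop), Measure.map_smul,
    Measure.map_smul, Measure.map_dirac' (by fun_prop), Measure.map_dirac' (by fun_prop), h,
    add_comm]
  simp

namespace DilutedLattice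

/-! ### Transformations preserving the law: resampling, tie flips, vertical shifts. -/

/-- The configuration that agrees with the first one on the occupation variables in the layers
before `L` and on the tie-breaking variables in the layers up to `L`, and with the second one
elsewhere. -/
def resample (L : ℤ) (q : Config × Config) : Config := fun x =>
  (if x.1.1 < L then (q.1 x).1 else (q.2 x).1, if x.1.1 ≤ L then (q.1 x).2 else (q.2 x).2)

/-- Negate the tie-breaking choice at `z`. -/
def flipTie (z : Node) (ω : Config) : Config := fun x =>
  ((ω x).1, if x = z then !(ω x).2 else (ω x).2)

/-- Translation of nodes by `2 * j` in the vertical direction. -/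
def shiftNode (j : ℤ) : Node ≃ Node where
  toFun x := ⟨(x.1.1, x.1.2 + 2 * j), by
    have := x.2; simp only [Int.even_iff] at *; omega⟩
  invFun x := ⟨(x.1.1, x.1.2 - 2 * j), by
    have := x.2; simp only [Int.even_iff] at *; omega⟩
  left_inv x := by ext <;> simp
  right_inv x := by ext <;> simp

namespace ThinningField

variable (p : ThinningField) (ℓ : ℝ)

instance : IsProbabilityMeasure (p.law ℓ) := by
  unfold ThinningField.law; infer_instance

theorem measurable_resample (L : ℤ) : Measurable (resample L) := by
  refine measurable_pi_iff.2 fun x => ?_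
  unfold resample
  split_ifs <;> fun_prop

/-- The marginal laws of the occupation variables (`false`) and of the tie-breaking variables
(`true`). -/
noncomputable def marginal (x : Node) (b : Bool) : Measure Bool :=
  bernoulliMeasure true false (if b then half else p.prob ℓ x)

instance (x : Node) (b : Bool) : IsProbabilityMeasure (p.marginal ℓ x b) := by
  unfold marginal; infer_instance

/-- Gather independent bits into a configuration. -/
def ofBits (η : Node × Bool → Bool) : Config := fun x => (η (x, false), η (x, true))

theorem measurable_ofBits : Measurable ofBits := by
  unfold ofBits; fun_prop

/-- Resampling separates the two bits of a node in layer `L`, so the law must be seen as a product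
over single bits rather than over nodes. -/
theorem law_eq_map_ofBits :
    p.law ℓ = (Measure.infinitePi fun i : Node × Bool => p.marginal ℓ i.1 i.2).map ofBits := by
  have h : ofBits = (fun (f : Node → Bool → Bool) x => (f x false, f x true)) ∘
      MeasurableEquiv.curry Node Bool Bool := rfl
  rw [h, ← Measure.map_map (by fun_prop) (by fun_prop), Measure.infinitePi_map_curry,
    Measure.infinitePi_map_pi (f := fun _ (g : Bool → Bool) => (g false, g true)) _
      (fun _ => by fun_prop)]
  unfold law
  congr 1
  ext1 x
  refine Measure.prod_eq fun s t hs ht => ?_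
  have : (fun g : Bool → Bool => (g false, g true)) ⁻¹' (s ×ˢ t) =
      ((Finset.univ : Finset Bool) : Set Bool).pi fun b => if b then t else s := by
    ext g; simp [and_comm]
  rw [Measure.map_apply (by fun_prop) (hs.prod ht), this,
    Measure.infinitePi_pi _ (by intro i _; split_ifs <;> assumption)]
  simp [marginal, mul_comm]

theorem measurePreserving_resample (L : ℤ) :
    MeasurePreserving (resample L) ((p.law ℓ).prod (p.law ℓ)) (p.law ℓ) := by
  classical
  refine ⟨measurable_resample L, ?_⟩
  let A : Set (Node × Bool) := {i | if i.2 then i.1.1.1 ≤ L else i.1.1.1 < L}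
  have hc : resample L ∘ Prod.map ofBits ofBits =
      ofBits ∘ fun q : (Node × Bool → Bool) × (Node × Bool → Bool) => A.piecewise q.1 q.2 := by
    funext q x
    simp [resample, ofBits, A, Set.piecewise]
  have hm : Measurable fun q : (Node × Bool → Bool) × (Node × Bool → Bool) =>
      A.piecewise q.1 q.2 := by
    refine measurable_pi_iff.2 fun i => ?_
    by_cases hi : i ∈ A
    · simp only [Set.piecewise, hi, if_true]; fun_prop
    · simp only [Set.piecewise, hi, if_false]; fun_prop
  rw [law_eq_map_ofBits, Measure.map_prod_map _ _ measurable_ofBits measurable_ofBits,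
    Measure.map_map (measurable_resample L) (measurable_ofBits.prodMap measurable_ofBits), hc,
    ← Measure.map_map measurable_ofBits hm, infinitePi_map_piecewise]

theorem measurePreserving_flipTie (z : Node) :
    MeasurePreserving (flipTie z) (p.law ℓ) (p.law ℓ) := by
  have hm : ∀ x : Node, Measurable fun b : Bool × Bool => (b.1, if x = z then !b.2 else b.2) :=
    fun x => by fun_prop
  refine ⟨measurable_pi_iff.2 fun x => (hm x).comp (measurable_pi_apply x), ?_⟩
  have h := Measure.infinitePi_map_pi (fun x : Node =>
    (bernoulliMeasure true false (p.prob ℓ x)).prod (bernoulliMeasure true false half)) hm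
  unfold law flipTie
  rw [h]
  congr 1
  ext1 x
  by_cases hx : x = z
  · simp only [hx, if_true]
    change Measure.map (Prod.map id not) _ = _
    rw [← Measure.map_prod_map _ _ (by fun_prop) (by fun_prop), map_not_bernoulliMeasure_half]
    simp
  · simp [hx]

theorem measurePreserving_shift (hp : p.VerticallyHomogeneous) (j : ℤ) :
    MeasurePreserving (fun (ω : Config) x => ω (shiftNode j x)) (p.law ℓ) (p.law ℓ) := by
  refine ⟨by fun_prop, ?_⟩
  have h := Measure.infinitePi_map_piCongrLeft (fun x : Node =>
    (bernoulliMeasure true false (p.prob ℓ x)).prod (bernoulliMeasure true false half))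
    (shiftNode j).symm
  have hq : ∀ x, p.prob ℓ ((shiftNode j).symm x) = p.prob ℓ x := fun x =>
    Subtype.ext (hp _ _ _)
  simp only [hq] at h
  unfold law
  convert h using 2
  funext ω x
  obtain ⟨y, rfl⟩ := (shiftNode j).symm.surjective x
  simp [MeasurableEquiv.coe_piCongrLeft, Equiv.piCongrLeft_apply_apply]

end ThinningField

/-! ### The selection relation: uniqueness, locality, equivariance, measurability. -/

/-- The node `y` is the one selected by `x` (occupied or not) in the layer to its left. -/
def Selects (ω : Config) (x y : Node) : Prop :=
  IsNearest ω x y ∧ ∀ z : Node, IsNearest ω x z → z ≠ y →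
    if (ω x).2 = true then z.1.2 < y.1.2 else y.1.2 < z.1.2

theorem Selects.unique {ω : Config} {x y y' : Node} (h : Selects ω x y) (h' : Selects ω x y') :
    y = y' := by
  by_contra hne
  have h1 := h.2 y' h'.1 (Ne.symm hne)
  have h2 := h'.2 y h.1 hne
  split_ifs at h1 h2 <;> omega

theorem Selects.fst_eq {ω : Config} {x y : Node} (h : Selects ω x y) : y.1.1 = x.1.1 - 1 := h.1.1

theorem isNearest_congr {ω ω' : Config} {x y : Node}
    (h : ∀ z : Node, z.1.1 = x.1.1 - 1 → (ω z).1 = (ω' z).1) :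
    IsNearest ω x y ↔ IsNearest ω' x y := by
  unfold IsNearest Occupied
  refine and_congr_right fun hy => and_congr (by rw [h y hy]) (forall_congr' fun z => ?_)
  exact forall_congr' fun hz => by rw [h z hz]

theorem selects_congr {ω ω' : Config} {x y : Node}
    (h : ∀ z : Node, z.1.1 = x.1.1 - 1 → (ω z).1 = (ω' z).1) (hx : (ω x).2 = (ω' x).2) :
    Selects ω x y ↔ Selects ω' x y := by
  unfold Selects
  rw [isNearest_congr h, hx]
  exact and_congr_right fun _ => forall_congr' fun z => by rw [isNearest_congr h]

theorem isNearest_shift (j : ℤ) (ω : Config) (x y : Node) :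
    IsNearest (fun u => ω (shiftNode j u)) x y ↔ IsNearest ω (shiftNode j x) (shiftNode j y) := by
  unfold IsNearest Occupied
  refine and_congr Iff.rfl (and_congr Iff.rfl ⟨fun h z => ?_, fun h z => ?_⟩)
  · obtain ⟨z, rfl⟩ := (shiftNode j).surjective z
    simpa [shiftNode] using h z
  · simpa [shiftNode] using h (shiftNode j z)

theorem selects_shift (j : ℤ) (ω : Config) (x y : Node) :
    Selects (fun u => ω (shiftNode j u)) x y ↔ Selects ω (shiftNode j x) (shiftNode j y) := by
  unfold Selects
  have hlt : ∀ u v, (shiftNode j u).1.2 < (shiftNode j v).1.2 ↔ u.1.2 < v.1.2 := fun u v => by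
    simp [shiftNode]
  rw [isNearest_shift]
  refine and_congr Iff.rfl ((shiftNode j).forall_congr fun z => ?_)
  rw [isNearest_shift, (shiftNode j).injective.ne_iff]
  refine imp_congr_right fun _ => imp_congr_right fun _ => ?_
  split_ifs <;> simp [hlt]

theorem measurableSet_isNearest (x y : Node) : MeasurableSet {ω : Config | IsNearest ω x y} := by
  have ho : ∀ z : Node, MeasurableSet {ω : Config | Occupied ω z} := fun z =>
    (measurable_pi_apply z).fst (measurableSet_singleton true)
  have h : {ω : Config | IsNearest ω x y} = {ω | y.1.1 = x.1.1 - 1} ∩ ({ω | Occupied ω y} ∩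
      ⋂ z : Node, {ω : Config | z.1.1 = x.1.1 - 1 → Occupied ω z →
        |x.1.2 - y.1.2| ≤ |x.1.2 - z.1.2|}) := by
    ext ω; simp [IsNearest]
  rw [h]
  refine .inter (.const _) (.inter (ho y) ?_)
  exact .iInter fun z => .imp (.const _) (.imp (ho z) (.const _))

theorem measurableSet_selects (x y : Node) : MeasurableSet {ω : Config | Selects ω x y} := by
  have ht : MeasurableSet {ω : Config | (ω x).2 = true} :=
    (measurable_pi_apply x).snd (measurableSet_singleton true)
  have h : {ω : Config | Selects ω x y} = {ω | IsNearest ω x y} ∩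
      ⋂ z : Node, {ω : Config | IsNearest ω x z → z ≠ y →
        if (ω x).2 = true then z.1.2 < y.1.2 else y.1.2 < z.1.2} := by
    ext ω; simp [Selects]
  rw [h]
  refine .inter (measurableSet_isNearest x y) ?_
  refine .iInter fun z => .imp (measurableSet_isNearest x z) (.imp (.const _) ?_)
  have h' : {ω : Config | if (ω x).2 = true then z.1.2 < y.1.2 else y.1.2 < z.1.2} =
      {ω | (ω x).2 = true} ∩ {_ω | z.1.2 < y.1.2} ∪
        {ω | (ω x).2 = true}ᶜ ∩ {_ω | y.1.2 < z.1.2} := by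
    ext ω
    by_cases h : (ω x).2 = true <;> simp [h]
  rw [h']
  exact (ht.inter (.const _)).union (ht.compl.inter (.const _))

/-! ### One step of the backward exploration. -/

/-- The nodes that select an element of `S`. -/
def preds (ω : Config) (S : Finset Node) : Set Node := {x | ∃ y ∈ S, Selects ω x y}

open Classical in
/-- The nodes that select an element of `S`, as a finite set (`∅` if there are infinitely many). -/
noncomputable def step (ω : Config) (S : Finset Node) : Finset Node :=
  if h : (preds ω S).Finite then h.toFinset else ∅

theorem mem_preds_of_mem_step {ω : Config} {S : Finset Node} {x : Node} (h : x ∈ step ω S) :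
    x ∈ preds ω S := by
  unfold step at h
  split_ifs at h with hf
  · simpa using h
  · simp at h

@[simp] theorem step_empty (ω : Config) : step ω ∅ = ∅ := by
  ext x
  simp only [Finset.notMem_empty, iff_false]
  intro h
  simpa [preds] using mem_preds_of_mem_step h

theorem step_congr {ω ω' : Config} {S : Finset Node}
    (h : ∀ x, ∀ y ∈ S, (Selects ω x y ↔ Selects ω' x y)) : step ω S = step ω' S := by
  have : preds ω S = preds ω' S := by
    ext x
    exact exists_congr fun y => and_congr_right fun hy => h x y hy
  unfold step
  split_ifs with h1 h2 h2
  · simp [this]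
  · exact absurd (this ▸ h1) h2
  · exact absurd (this ▸ h2) h1
  · rfl

/-- Finite sets of nodes are given the discrete σ-algebra. -/
instance : MeasurableSpace (Finset Node) := ⊤

instance : DiscreteMeasurableSpace (Finset Node) := ⟨fun _ => trivial⟩

theorem measurableSet_preds_eq (S T : Finset Node) :
    MeasurableSet {ω : Config | preds ω S = T} := by
  have : {ω : Config | preds ω S = T} =
      ⋂ x : Node, {ω : Config | (∃ y ∈ S, Selects ω x y) ↔ x ∈ T} := by
    ext ω; simp [preds, Set.ext_iff]
  rw [this]
  refine .iInter fun x => .iff ?_ (.const _)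
  have h : {ω : Config | ∃ y ∈ S, Selects ω x y} = ⋃ y ∈ S, {ω : Config | Selects ω x y} := by
    ext ω; simp
  rw [h]
  exact .biUnion (Set.to_countable _) fun y _ => measurableSet_selects x y

/-- A nonempty value `T` occurs exactly when `preds ω S = T`. The value `∅` also stands for infinite
`preds`, so its event is obtained as the complement of the countably many others. -/
theorem measurable_step (S : Finset Node) : Measurable fun ω : Config => step ω S := by
  classical
  have hpos : ∀ T : Finset Node, T ≠ ∅ →
      MeasurableSet ((fun ω : Config => step ω S) ⁻¹' {T}) := by
    intro T hT
    convert measurableSet_preds_eq S T using 1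
    ext ω
    simp only [Set.mem_preimage, Set.mem_singleton_iff, Set.mem_ofPred_eq, step]
    split_ifs with h
    · rw [← Finset.coe_inj]; simp
    · exact ⟨fun e => absurd e.symm hT, fun e => absurd (e ▸ T.finite_toSet) h⟩
  refine measurable_to_countable' fun T => ?_
  by_cases hT : T = ∅
  · have : (fun ω : Config => step ω S) ⁻¹' {T} =
        (⋃ U ∈ {U : Finset Node | U ≠ ∅}, (fun ω : Config => step ω S) ⁻¹' {U})ᶜ := by
      ext ω; simp [hT, imp_not_comm]
    rw [this]
    exact (MeasurableSet.biUnion (Set.to_countable _) fun U hU => hpos U hU).compl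
  · exact hpos T hT

theorem measurable_step_uncurry : Measurable fun q : Config × Finset Node => step q.1 q.2 :=
  measurable_from_prod_countable_left fun S => measurable_step S

/-! ### First moment of the step: mass transport. -/

namespace ThinningField

variable {p : ThinningField} (ℓ : ℝ)

/-- Mass transport: the sum over selectors of a fixed target becomes, after shifts, a sum over
targets of a fixed selector. The latter events are disjoint since a node selects at most one node.
-/
theorem tsum_law_selects_le_one (hp : p.VerticallyHomogeneous) (y : Node) :
    ∑' x, p.law ℓ {ω | Selects ω x y} ≤ 1 := by
  let x₀ : Node := ⟨(y.1.1 + 1, y.1.2 + 1), by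
    have := y.2; simp only [Int.even_iff] at *; omega⟩
  have hinj : Function.Injective fun j : ℤ => shiftNode j x₀ := fun i j h => by
    simpa [shiftNode] using h
  have hsupp : Function.support (fun x => p.law ℓ {ω | Selects ω x y}) ⊆
      Set.range fun j : ℤ => shiftNode j x₀ := by
    intro x hx
    have : ({ω | Selects ω x y} : Set Config).Nonempty := by
      by_contra hemp
      rw [Set.not_nonempty_iff_eq_empty] at hemp
      exact hx (by simp [hemp])
    obtain ⟨ω, hω⟩ := this
    have h1 := hω.fst_eq
    have h2 := x.2
    have h3 := y.2
    simp only [Int.even_iff] at h2 h3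
    refine ⟨(x.1.2 - y.1.2 - 1) / 2, Subtype.ext (Prod.ext ?_ ?_)⟩ <;>
      simp only [shiftNode, x₀, Equiv.coe_fn_mk] <;> omega
  rw [← hinj.tsum_eq hsupp]
  -- Vertical homogeneity acts here: raising the selector amounts to lowering the target.
  have hs : ∀ j : ℤ, p.law ℓ {ω | Selects ω (shiftNode j x₀) y} =
      p.law ℓ {ω | Selects ω x₀ (shiftNode (-j) y)} := by
    intro j
    rw [← (p.measurePreserving_shift ℓ hp (-j)).measure_preimage
      (measurableSet_selects _ _).nullMeasurableSet]
    congr 1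
    ext ω
    simp only [Set.preimage_ofPred_eq, Set.mem_ofPred_eq, selects_shift]
    rw [show shiftNode (-j) (shiftNode j x₀) = x₀ by ext <;> simp [shiftNode]]
  simp_rw [hs]
  rw [← measure_iUnion _ fun j => measurableSet_selects _ _]
  · exact prob_le_one
  · intro i j hij
    refine Set.disjoint_left.2 fun ω h1 h2 => hij ?_
    simpa [shiftNode] using Selects.unique h1 h2

/-- Borel–Cantelli, applied to the summable selection probabilities. Almost surely `step` therefore
never takes its default value. -/
theorem ae_finite_setOf_selects (hp : p.VerticallyHomogeneous) :
    ∀ᵐ ω ∂p.law ℓ, ∀ y, {x | Selects ω x y}.Finite :=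
  ae_all_iff.2 fun y => ae_finite_setOfPred_mem
    ((tsum_law_selects_le_one ℓ hp y).trans_lt ENNReal.one_lt_top).ne

open Classical in
theorem lintegral_card_step_le (hp : p.VerticallyHomogeneous) (S : Finset Node) :
    ∫⁻ ω, ((step ω S).card : ℝ≥0∞) ∂p.law ℓ ≤ S.card := by
  have hm : ∀ x y : Node, Measurable fun ω : Config => if Selects ω x y then (1 : ℝ≥0∞) else 0 :=
    fun x y => Measurable.ite (measurableSet_selects x y) measurable_const measurable_const
  have hle : ∀ ω : Config, ((step ω S).card : ℝ≥0∞) ≤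
      ∑ y ∈ S, ∑' x, if Selects ω x y then (1 : ℝ≥0∞) else 0 := by
    intro ω
    rw [Finset.card_eq_sum_ones, Nat.cast_sum]
    calc ∑ x ∈ step ω S, ((1 : ℕ) : ℝ≥0∞)
        ≤ ∑ x ∈ step ω S, ∑ y ∈ S, if Selects ω x y then (1 : ℝ≥0∞) else 0 := by
          refine Finset.sum_le_sum fun x hx => ?_
          obtain ⟨y, hy, hxy⟩ := mem_preds_of_mem_step hx
          refine le_trans ?_ (Finset.single_le_sum (fun _ _ => zero_le) hy)
          simp [hxy]
      _ = ∑ y ∈ S, ∑ x ∈ step ω S, if Selects ω x y then (1 : ℝ≥0∞) else 0 := Finset.sum_comm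
      _ ≤ _ := Finset.sum_le_sum fun y _ => ENNReal.sum_le_tsum _
  calc _ ≤ ∫⁻ ω, ∑ y ∈ S, ∑' x, (if Selects ω x y then (1 : ℝ≥0∞) else 0) ∂p.law ℓ :=
        lintegral_mono hle
    _ = ∑ y ∈ S, ∑' x, p.law ℓ {ω | Selects ω x y} := by
        rw [lintegral_finsetSum _ fun y _ => Measurable.tsum fun x => hm x y]
        refine Finset.sum_congr rfl fun y _ => ?_
        rw [lintegral_tsum fun x => (hm x y).aemeasurable]
        refine tsum_congr fun x => ?_
        rw [← lintegral_indicator_one (measurableSet_selects x y)]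
        rfl
    _ ≤ ∑ y ∈ S, 1 := Finset.sum_le_sum fun y _ => tsum_law_selects_le_one ℓ hp y
    _ = S.card := by simp

end ThinningField

end DilutedLattice

/-! ### Fluctuation of the step and growth of the exponential weight. -/

/-- For `t ≤ 2`, square `1 - t / 2 ≤ exp (-t / 2)` to gain `t ^ 2 / 4`; for larger `t` the left side
is negative. -/
theorem Real.one_sub_add_sq_div_four_le_exp_neg {l t : ℝ} (hl : 0 ≤ l) (hl1 : l ≤ 1)
    (ht : l ≤ |t|) : 1 - t + l ^ 2 / 4 ≤ Real.exp (-t) := by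
  rcases le_total t 2 with h | h
  · have h1 : 1 - t / 2 ≤ Real.exp (-(t / 2)) := by
      have := Real.add_one_le_exp (-(t / 2)); linarith
    have h2 : Real.exp (-t) = Real.exp (-(t / 2)) ^ 2 := by
      rw [← Real.exp_nat_mul]; congr 1; push_cast; ring
    have h3 : l ^ 2 ≤ t ^ 2 := by rw [← sq_abs t]; exact pow_le_pow_left₀ hl ht 2
    have h4 : (1 - t / 2) ^ 2 ≤ Real.exp (-(t / 2)) ^ 2 :=
      pow_le_pow_left₀ (by linarith) h1 2
    rw [h2]; nlinarith
  · have := Real.exp_pos (-t)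
    nlinarith

namespace DilutedLattice

theorem selects_flipTie_iff {z x y : Node} (h : x ≠ z) (ω : Config) :
    Selects (flipTie z ω) x y ↔ Selects ω x y :=
  selects_congr (fun _ _ => rfl) (by simp [flipTie, h])

/-- If the two neighbours of `z` in the layer to its left are occupied, then `z` selects the upper
or the lower one according to its tie-breaking choice. -/
theorem selects_of_neighbours {ω : Config} {z u d : Node} (hu1 : u.1.1 = z.1.1 - 1)
    (hd1 : d.1.1 = z.1.1 - 1) (hu2 : u.1.2 = z.1.2 + 1) (hd2 : d.1.2 = z.1.2 - 1)
    (hu : Occupied ω u) (hd : Occupied ω d) :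
    Selects ω z (if (ω z).2 = true then u else d) := by
  have hdist : ∀ w : Node, w.1.1 = z.1.1 - 1 → 1 ≤ |z.1.2 - w.1.2| := fun w hw => by
    have h1 := z.2
    have h2 := w.2
    simp only [Int.even_iff] at h1 h2
    exact Int.one_le_abs (by omega)
  have hnear : ∀ w : Node, IsNearest ω z w → w = u ∨ w = d := fun w hw => by
    have h1 := hw.2.2 u hu1 hu
    rw [hu2, show z.1.2 - (z.1.2 + 1) = -1 by ring, abs_neg, abs_one, abs_le] at h1
    have h2 := hdist w hw.1
    have h3 : w.1.2 = z.1.2 + 1 ∨ w.1.2 = z.1.2 - 1 := by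
      rcases le_abs.1 h2 with h | h <;> omega
    rcases h3 with h | h
    · exact .inl (Subtype.ext (Prod.ext (hw.1.trans hu1.symm) (h.trans hu2.symm)))
    · exact .inr (Subtype.ext (Prod.ext (hw.1.trans hd1.symm) (h.trans hd2.symm)))
  have hun : IsNearest ω z u := ⟨hu1, hu, fun w hw _ => by
    rw [hu2, show z.1.2 - (z.1.2 + 1) = -1 by ring, abs_neg, abs_one]; exact hdist w hw⟩
  have hdn : IsNearest ω z d := ⟨hd1, hd, fun w hw _ => by
    rw [hd2, show z.1.2 - (z.1.2 - 1) = 1 by ring, abs_one]; exact hdist w hw⟩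
  split_ifs with h
  · refine ⟨hun, fun w hw hne => ?_⟩
    rw [if_pos h]
    rcases hnear w hw with rfl | rfl
    · exact absurd rfl hne
    · omega
  · refine ⟨hdn, fun w hw hne => ?_⟩
    rw [if_neg h]
    rcases hnear w hw with rfl | rfl
    · omega
    · exact absurd rfl hne

/-- The tie at `z` decides between `d ∈ S` and `u ∉ S`, so flipping it toggles the membership of `z`
and of no other node. The size changes by exactly one. -/
theorem card_step_flipTie_ne {ω : Config} {S : Finset Node} (hS : S.Nonempty) {z u d : Node}
    (hu1 : u.1.1 = z.1.1 - 1) (hd1 : d.1.1 = z.1.1 - 1) (hu2 : u.1.2 = z.1.2 + 1)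
    (hd2 : d.1.2 = z.1.2 - 1) (hu : Occupied ω u) (hd : Occupied ω d) (huS : u ∉ S) (hdS : d ∈ S)
    (hcard : (step ω S).card = S.card) : (step (flipTie z ω) S).card ≠ S.card := by
  classical
  set ω' := flipTie z ω with hω'
  have hz : ∀ η : Config, Occupied η u → Occupied η d → (z ∈ preds η S ↔ (η z).2 = false) := by
    intro η h1 h2
    have h := selects_of_neighbours hu1 hd1 hu2 hd2 h1 h2
    constructor
    · rintro ⟨y, hy, hzy⟩
      by_contra hf
      rw [if_pos (by simpa using hf)] at h
      exact huS (h.unique hzy ▸ hy)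
    · intro hf
      rw [if_neg (by simp [hf])] at h
      exact ⟨d, hdS, h⟩
  have hdiff : ∀ x, x ≠ z → (x ∈ preds ω' S ↔ x ∈ preds ω S) := fun x hx =>
    exists_congr fun y => and_congr_right fun _ => selects_flipTie_iff hx ω
  have hzz : z ∈ preds ω' S ↔ z ∉ preds ω S := by
    rw [hz ω hu hd, hz ω' hu hd]
    simp [hω', flipTie]
  -- Otherwise `step` is `∅` by default, of size 0, while `S` is nonempty.
  have hfin : (preds ω S).Finite := by
    by_contra hinf
    simp only [step, hinf, dite_false, Finset.card_empty] at hcard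
    exact hS.card_pos.ne hcard
  have hfin' : (preds ω' S).Finite := (hfin.insert z).subset fun x hx => by
    by_cases h : x = z
    · exact .inl h
    · exact .inr ((hdiff x h).1 hx)
  have hmem : ∀ x, x ∈ step ω S ↔ x ∈ preds ω S := fun x => by simp [step, hfin]
  have hmem' : ∀ x, x ∈ step ω' S ↔ x ∈ preds ω' S := fun x => by simp [step, hfin']
  have herase : (step ω' S).erase z = (step ω S).erase z := by
    ext x
    simp only [Finset.mem_erase, hmem, hmem']
    exact and_congr_right (hdiff x)
  have hc := congrArg Finset.card herase
  rw [Finset.card_erase_eq_ite, Finset.card_erase_eq_ite] at hc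
  have hpos := hS.card_pos
  simp only [hmem, hmem', hzz] at hc
  intro h'
  by_cases h : z ∈ preds ω S
  · simp only [h, not_true_eq_false, if_true, if_false] at hc; omega
  · simp only [h, not_false_eq_true, if_true, if_false] at hc; omega

namespace ThinningField

variable {p : ThinningField} (ℓ : ℝ)

theorem law_occupied_inter {c : ℝ} (hc : ∀ z, c ≤ p.toFun z) {u d : Node} (hne : u ≠ d) :
    ENNReal.ofReal c * ENNReal.ofReal c ≤ p.law ℓ {ω | Occupied ω u ∧ Occupied ω d} := by
  classical
  have : {ω : Config | Occupied ω u ∧ Occupied ω d} =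
      (({u, d} : Finset Node) : Set Node).pi fun _ => {true} ×ˢ Set.univ := by
    ext ω; simp [Occupied]
  rw [this, law, Measure.infinitePi_pi _ fun _ _ => (measurableSet_singleton _).prod .univ,
    Finset.prod_pair hne]
  have hb : ∀ x : Node, ENNReal.ofReal c ≤
      ((bernoulliMeasure true false (p.prob ℓ x)).prod (bernoulliMeasure true false half))
        ({true} ×ˢ Set.univ) := by
    intro x
    rw [Measure.prod_prod, measure_univ, mul_one,
      bernoulliMeasure_apply_of_mem_of_notMem _ (measurableSet_singleton _) rfl (by simp)]
    rw [ENNReal.ofReal, ENNReal.coe_le_coe, Real.toNNReal_le_iff_le_coe]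
    exact hc _
  exact mul_le_mul' (hb u) (hb d)

/-- Take `d` topmost in `S`, so the node `u` two units above it lies outside `S`, and let `z` be
their common right neighbour. When both are occupied, which has probability at least `c ^ 2`, the
size changes either before or after flipping the tie at `z`. The flip preserves the law, whence the
factor 1/2. -/
theorem le_law_card_step_ne {c : ℝ} (hc : ∀ z, c ≤ p.toFun z) (hc0 : 0 < c) {S : Finset Node}
    (hS : S.Nonempty) : c ^ 2 / 2 ≤ (p.law ℓ).real {ω | (step ω S).card ≠ S.card} := by
  obtain ⟨d, hdS, hmax⟩ := S.exists_max_image (fun x => x.1.2) hS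
  let z : Node := ⟨(d.1.1 + 1, d.1.2 + 1), by
    have := d.2; simp only [Int.even_iff] at *; omega⟩
  let u : Node := ⟨(d.1.1, d.1.2 + 2), by
    have := d.2; simp only [Int.even_iff] at *; omega⟩
  have hm : MeasurableSet {ω | (step ω S).card ≠ S.card} :=
    measurable_step S (.of_discrete (s := {T : Finset Node | T.card ≠ S.card}))
  have hsub : {ω : Config | Occupied ω u ∧ Occupied ω d} ⊆
      {ω | (step ω S).card ≠ S.card} ∪ flipTie z ⁻¹' {ω | (step ω S).card ≠ S.card} := by
    rintro ω ⟨hu, hd⟩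
    by_cases h : (step ω S).card = S.card
    · refine .inr (card_step_flipTie_ne hS ?_ ?_ ?_ ?_ hu hd (fun hu => ?_) hdS h)
      · simp [u, z]
      · simp [z]
      · simp only [u, z]; omega
      · simp [z]
      · have := hmax u hu
        simp only [u] at this
        omega
    · exact .inl h
  have hne : u ≠ d := fun h => by
    have := congrArg (fun x : Node => x.1.2) h
    simp [u] at this
  have h1 := (law_occupied_inter ℓ hc hne).trans ((measure_mono hsub).trans (measure_union_le _ _))
  rw [(p.measurePreserving_flipTie ℓ z).measure_preimage hm.nullMeasurableSet,
    ← ENNReal.ofReal_mul hc0.le] at h1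
  have h2 := (ENNReal.ofReal_le_iff_le_toReal (by finiteness)).1 h1
  rw [ENNReal.toReal_add (by finiteness) (by finiteness)] at h2
  rw [measureReal_def]
  linarith

theorem integrable_card_step (hp : p.VerticallyHomogeneous) (S : Finset Node) :
    Integrable (fun ω => ((step ω S).card : ℝ)) (p.law ℓ) := by
  refine ⟨((Measurable.of_discrete (f := fun T : Finset Node => (T.card : ℝ))).comp
    (measurable_step S)).aestronglyMeasurable, ?_⟩
  rw [hasFiniteIntegral_iff_ofReal (.of_forall fun _ => by positivity)]
  simp only [ENNReal.ofReal_natCast]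
  exact (lintegral_card_step_le ℓ hp S).trans_lt (by finiteness)

theorem integral_card_step_le (hp : p.VerticallyHomogeneous) (S : Finset Node) :
    ∫ ω, ((step ω S).card : ℝ) ∂p.law ℓ ≤ S.card := by
  have h := ofReal_integral_eq_lintegral_ofReal (integrable_card_step ℓ hp S)
    (.of_forall fun _ => by positivity)
  simp only [ENNReal.ofReal_natCast] at h
  have h1 := h.le.trans (lintegral_card_step_le ℓ hp S)
  rwa [← ENNReal.ofReal_natCast, ENNReal.ofReal_le_ofReal_iff (by positivity)] at h1

/-- The exponential weight of a finite set. -/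
noncomputable def _root_.DilutedLattice.expWeight (l : ℝ) (S : Finset Node) : ℝ :=
  Real.exp (-(l * S.card))

theorem _root_.DilutedLattice.integrable_expWeight {Ω : Type*} [MeasurableSpace Ω]
    (μ : Measure Ω) [IsFiniteMeasure μ] {l : ℝ} (hl : 0 ≤ l) {f : Ω → Finset Node}
    (hf : Measurable f) : Integrable (fun ω => expWeight l (f ω)) μ :=
  Integrable.of_bound ((Measurable.of_discrete (f := expWeight l)).comp hf).aestronglyMeasurable 1
    (.of_forall fun ω => by
      rw [Real.norm_eq_abs, expWeight, Real.abs_exp, Real.exp_le_one_iff]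
      have : 0 ≤ l * (f ω).card := by positivity
      linarith)

/-- The linear term of the exponential has a favourable sign by the first moment bound; the
quadratic gain `l ^ 2 / 4` on an event of probability at least `c ^ 2 / 2` gives `c ^ 2 / 8 * l ^
2`. -/
theorem le_integral_expWeight_step (hp : p.VerticallyHomogeneous) {c : ℝ}
    (hc : ∀ z, c ≤ p.toFun z) (hc0 : 0 < c) {l : ℝ} (hl : 0 ≤ l) (hl1 : l ≤ 1) {S : Finset Node}
    (hS : S.Nonempty) :
    (1 + c ^ 2 / 8 * l ^ 2) * expWeight l S ≤ ∫ ω, expWeight l (step ω S) ∂p.law ℓ := by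
  set A : Set Config := {ω | (step ω S).card ≠ S.card}
  have hm : MeasurableSet A :=
    measurable_step S (.of_discrete (s := {T : Finset Node | T.card ≠ S.card}))
  have hpt : ∀ ω, expWeight l S * (1 - l * ((step ω S).card - S.card)
      + A.indicator (fun _ => l ^ 2 / 4) ω) ≤ expWeight l (step ω S) := by
    intro ω
    have h1 : expWeight l (step ω S) =
        expWeight l S * Real.exp (-(l * ((step ω S).card - S.card))) := by
      rw [expWeight, expWeight, ← Real.exp_add]; congr 1; ring
    rw [h1]
    refine mul_le_mul_of_nonneg_left ?_ (Real.exp_pos _).le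
    by_cases hω : ω ∈ A
    · rw [Set.indicator_of_mem hω]
      refine Real.one_sub_add_sq_div_four_le_exp_neg hl hl1 ?_
      rw [abs_mul, abs_of_nonneg hl]
      refine le_mul_of_one_le_right hl ?_
      have : (1 : ℤ) ≤ |((step ω S).card : ℤ) - S.card| :=
        Int.one_le_abs (sub_ne_zero.2 (by exact_mod_cast hω))
      exact_mod_cast this
    · rw [Set.indicator_of_notMem hω, add_zero]
      have := Real.add_one_le_exp (-(l * (((step ω S).card : ℝ) - S.card)))
      linarith
  have hi := integrable_card_step ℓ hp S
  have hi1 : Integrable (fun ω => 1 - l * (((step ω S).card : ℝ) - S.card)) (p.law ℓ) := by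
    fun_prop
  have hi2 : Integrable (A.indicator fun _ => l ^ 2 / 4) (p.law ℓ) :=
    (integrable_const _).indicator hm
  have hmono := integral_mono ((hi1.add hi2).const_mul (expWeight l S))
    (integrable_expWeight (p.law ℓ) hl (measurable_step S)) hpt
  refine le_trans ?_ hmono
  rw [integral_const_mul, mul_comm]
  refine mul_le_mul_of_nonneg_left ?_ (Real.exp_pos _).le
  simp only [Pi.add_apply]
  rw [integral_add hi1 hi2, integral_indicator_const _ hm, integral_sub (integrable_const _)
    (by fun_prop), integral_const_mul, integral_sub hi (integrable_const _)]
  simp only [integral_const, probReal_univ, smul_eq_mul, one_mul]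
  have h1 := integral_card_step_le ℓ hp S
  have h2 := le_law_card_step_ne ℓ hc hc0 hS
  have h3 : l * (∫ ω, ((step ω S).card : ℝ) ∂p.law ℓ - S.card) ≤ 0 :=
    mul_nonpos_of_nonneg_of_nonpos hl (by linarith)
  have h4 : c ^ 2 / 2 * (l ^ 2 / 4) ≤ (p.law ℓ).real A * (l ^ 2 / 4) :=
    mul_le_mul_of_nonneg_right h2 (by positivity)
  linarith

end ThinningField

/-! ### Iterated exploration and its Markov property. -/

/-- The nodes whose selection chain of length `k` ends in `S`. -/
noncomputable def ancestors (ω : Config) (S : Finset Node) : ℕ → Finset Node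
  | 0 => S
  | k + 1 => step ω (ancestors ω S k)

theorem measurable_ancestors (S : Finset Node) (k : ℕ) :
    Measurable fun ω => ancestors ω S k := by
  induction k with
  | zero => exact measurable_const
  | succ k ih => exact measurable_step_uncurry.comp (measurable_id.prodMk ih)

theorem fst_eq_of_mem_ancestors {ω : Config} {S : Finset Node} {a : ℤ}
    (hS : ∀ x ∈ S, x.1.1 = a) {k : ℕ} {x : Node} (hx : x ∈ ancestors ω S k) : x.1.1 = a + k := by
  induction k generalizing x with
  | zero => simpa using hS x hx
  | succ k ih =>
    obtain ⟨y, hy, hxy⟩ := mem_preds_of_mem_step hx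
    have h1 := ih hy
    have h2 := hxy.fst_eq
    push_cast
    omega

/-- Selecting into layer `L` reads the occupation bits of layer `L` but the ties of layer `L + 1`;
hence the staggered cut in `resample`. -/
theorem step_congr_layer {ω ω' : Config} {S : Finset Node} {L : ℤ} (hS : ∀ x ∈ S, x.1.1 = L)
    (h1 : ∀ x : Node, x.1.1 = L → (ω x).1 = (ω' x).1)
    (h2 : ∀ x : Node, x.1.1 = L + 1 → (ω x).2 = (ω' x).2) : step ω S = step ω' S := by
  refine step_congr fun x y hy => ?_
  have hyL := hS y hy
  by_cases hx : x.1.1 = L + 1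
  · exact selects_congr (fun z hz => h1 z (by omega)) (h2 x hx)
  · refine iff_of_false (fun h => ?_) (fun h => ?_) <;>
    · have := h.fst_eq
      omega

theorem ancestors_congr {ω ω' : Config} {S : Finset Node} {a : ℤ} (hS : ∀ x ∈ S, x.1.1 = a)
    (k : ℕ) (h1 : ∀ x : Node, x.1.1 < a + k → (ω x).1 = (ω' x).1)
    (h2 : ∀ x : Node, x.1.1 ≤ a + k → (ω x).2 = (ω' x).2) :
    ancestors ω S k = ancestors ω' S k := by
  induction k with
  | zero => rfl
  | succ k ih =>
    push_cast at h1 h2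
    rw [ancestors, ancestors, ih (fun x hx => h1 x (by omega)) (fun x hx => h2 x (by omega))]
    exact step_congr_layer (fun x hx => fst_eq_of_mem_ancestors hS hx)
      (fun x hx => h1 x (by omega)) (fun x hx => h2 x (by omega))

theorem ancestors_succ_resample {S : Finset Node} {a : ℤ} (hS : ∀ x ∈ S, x.1.1 = a) (k : ℕ)
    (q : Config × Config) :
    ancestors (resample (a + k) q) S (k + 1) = step q.2 (ancestors q.1 S k) := by
  rw [ancestors, ancestors_congr hS k (ω' := q.1) (fun x hx => by simp [resample, hx])
    (fun x hx => by simp [resample, hx])]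
  exact step_congr_layer (fun x hx => fst_eq_of_mem_ancestors hS hx)
    (fun x hx => by simp [resample, hx]) (fun x hx => by simp [resample, hx])

namespace ThinningField

variable {p : ThinningField} (ℓ : ℝ)

theorem integral_expWeight_ancestors_succ {l : ℝ} (hl : 0 ≤ l) {S : Finset Node} {a : ℤ}
    (hS : ∀ x ∈ S, x.1.1 = a) (k : ℕ) :
    ∫ ω, expWeight l (ancestors ω S (k + 1)) ∂p.law ℓ =
      ∫ ω, ∫ ω', expWeight l (step ω' (ancestors ω S k)) ∂p.law ℓ ∂p.law ℓ := by
  have hR := p.measurePreserving_resample ℓ (a + k)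
  have hm := measurable_ancestors S (k + 1)
  have hm2 : Measurable fun q : Config × Config => step q.2 (ancestors q.1 S k) :=
    measurable_step_uncurry.comp
      (measurable_snd.prodMk ((measurable_ancestors S k).comp measurable_fst))
  rw [← integral_prod (fun q : Config × Config => expWeight l (step q.2 (ancestors q.1 S k)))
    (integrable_expWeight _ hl hm2)]
  simp_rw [← ancestors_succ_resample hS k]
  conv_lhs => rw [← hR.map_eq]
  exact integral_map hR.measurable.aemeasurable
    (by rw [hR.map_eq]; exact (integrable_expWeight _ hl hm).aestronglyMeasurable)

/-! ### Survival estimate. -/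

/-- The probability that a finite set still has ancestors after `k` steps. -/
noncomputable def survival (p : ThinningField) (ℓ : ℝ) (S : Finset Node) (k : ℕ) : ℝ :=
  (p.law ℓ).real {ω | (ancestors ω S k).Nonempty}

theorem measurableSet_ancestors_nonempty (S : Finset Node) (k : ℕ) :
    MeasurableSet {ω : Config | (ancestors ω S k).Nonempty} :=
  measurable_ancestors S k (.of_discrete (s := {T : Finset Node | T.Nonempty}))

theorem survival_antitone (S : Finset Node) : Antitone (p.survival ℓ S) := by
  refine antitone_nat_of_succ_le fun k => measureReal_mono fun ω hω => ?_
  by_contra h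
  have h0 : ancestors ω S k = ∅ := Finset.not_nonempty_iff_eq_empty.1 h
  have h1 : (ancestors ω S (k + 1)).Nonempty := hω
  rw [ancestors, h0, step_empty] at h1
  exact Finset.not_nonempty_empty h1

/-- The weight grows only on the survival event. The empty set has weight 1, so restricting the mean
to survival costs the extinction probability; the maximum with 0 records that the gain is
nonnegative. -/
theorem integral_expWeight_ancestors_add_le (hp : p.VerticallyHomogeneous) {c : ℝ}
    (hc : ∀ z, c ≤ p.toFun z) (hc0 : 0 < c) {l : ℝ} (hl : 0 ≤ l) (hl1 : l ≤ 1) {S : Finset Node}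
    {a : ℤ} (hS : ∀ x ∈ S, x.1.1 = a) (k : ℕ) :
    ∫ ω, expWeight l (ancestors ω S k) ∂p.law ℓ + c ^ 2 / 8 * l ^ 2 *
      max 0 (∫ ω, expWeight l (ancestors ω S k) ∂p.law ℓ + p.survival ℓ S k - 1) ≤
        ∫ ω, expWeight l (ancestors ω S (k + 1)) ∂p.law ℓ := by
  classical
  rw [integral_expWeight_ancestors_succ ℓ hl hS]
  set N : Set Config := {ω | (ancestors ω S k).Nonempty}
  have hN : MeasurableSet N := measurableSet_ancestors_nonempty S k
  have hint := integrable_expWeight (p.law ℓ) hl (measurable_ancestors S k)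
  have hm2 : Measurable fun q : Config × Config => step q.2 (ancestors q.1 S k) :=
    measurable_step_uncurry.comp
      (measurable_snd.prodMk ((measurable_ancestors S k).comp measurable_fst))
  have hint2 : Integrable (fun ω => ∫ ω', expWeight l (step ω' (ancestors ω S k)) ∂p.law ℓ)
      (p.law ℓ) := (integrable_expWeight ((p.law ℓ).prod (p.law ℓ)) hl hm2).integral_prod_left
  have hind : Integrable (N.indicator fun ω => expWeight l (ancestors ω S k)) (p.law ℓ) :=
    hint.indicator hN
  have hpt : ∀ ω, expWeight l (ancestors ω S k) + c ^ 2 / 8 * l ^ 2 *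
      N.indicator (fun ω => expWeight l (ancestors ω S k)) ω ≤
        ∫ ω', expWeight l (step ω' (ancestors ω S k)) ∂p.law ℓ := by
    intro ω
    by_cases hω : ω ∈ N
    · rw [Set.indicator_of_mem hω]
      have := le_integral_expWeight_step ℓ hp hc hc0 hl hl1 (S := ancestors ω S k) hω
      linarith
    · have h0 : ancestors ω S k = ∅ := Finset.not_nonempty_iff_eq_empty.1 hω
      rw [Set.indicator_of_notMem hω, h0]
      simp
  have hle := integral_mono (hint.add (hind.const_mul _)) hint2 hpt
  simp only [Pi.add_apply] at hle
  rw [integral_add hint (hind.const_mul _), integral_const_mul] at hle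
  refine le_trans ?_ hle
  gcongr
  refine max_le (integral_nonneg fun ω => Set.indicator_nonneg (fun _ _ => (Real.exp_pos _).le) _) ?_
  have hsum : ∫ ω, expWeight l (ancestors ω S k) ∂p.law ℓ ≤
      ∫ ω, (N.indicator (fun ω => expWeight l (ancestors ω S k)) ω +
        Nᶜ.indicator (fun _ => 1) ω) ∂p.law ℓ := by
    refine integral_mono hint (hind.add ((integrable_const _).indicator hN.compl)) fun ω => ?_
    by_cases hω : ω ∈ N
    · simp [hω]
    · have h0 : ancestors ω S k = ∅ := Finset.not_nonempty_iff_eq_empty.1 hω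
      simp [hω, h0, expWeight]
  rw [integral_add hind ((integrable_const _).indicator hN.compl),
    integral_indicator_const _ hN.compl, probReal_compl_eq_one_sub hN, smul_eq_mul, mul_one] at hsum
  unfold survival
  linarith

theorem survival_le (hp : p.VerticallyHomogeneous) {c : ℝ} (hc : ∀ z, c ≤ p.toFun z) (hc0 : 0 < c)
    {S : Finset Node} {a : ℤ} (hS : ∀ x ∈ S, x.1.1 = a) {n : ℕ} (hn : 0 < n) :
    p.survival ℓ S n ≤ (8 / c ^ 2 + 1) * S.card / √n := by
  -- With this scale, `n` gains of order `l ^ 2` add up to order one, while the initial deficit is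
  -- only `card S / √n`.
  set l : ℝ := 1 / √n with hl_def
  have hn1 : (1 : ℝ) ≤ n := by exact_mod_cast hn
  have hsq : (1 : ℝ) ≤ √n := Real.one_le_sqrt.2 hn1
  have hl : 0 < l := by positivity
  have hl1 : l ≤ 1 := by rw [hl_def, div_le_one (by positivity)]; exact hsq
  have hll : n * l ^ 2 = 1 := by
    rw [hl_def, div_pow, Real.sq_sqrt (by positivity)]; field_simp
  set u : ℕ → ℝ := fun k => ∫ ω, expWeight l (ancestors ω S k) ∂p.law ℓ with hu
  set b : ℝ := c ^ 2 / 8 * l ^ 2 with hb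
  have hb0 : 0 ≤ b := by positivity
  have hstep : ∀ k, u k + b * max 0 (u k + p.survival ℓ S k - 1) ≤ u (k + 1) := fun k =>
    integral_expWeight_ancestors_add_le ℓ hp hc hc0 hl.le hl1 hS k
  have hmono : Monotone u := monotone_nat_of_le_succ fun k =>
    le_trans (le_add_of_nonneg_right (by positivity)) (hstep k)
  have hu0 : 1 - l * S.card ≤ u 0 := by
    simp only [hu, ancestors, integral_const, probReal_univ, smul_eq_mul, one_mul, expWeight]
    have := Real.add_one_le_exp (-(l * (S.card : ℝ)))
    linarith
  have hun : u n ≤ 1 := by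
    have h := integral_mono (integrable_expWeight (p.law ℓ) hl.le (measurable_ancestors S n))
      (integrable_const (1 : ℝ)) fun ω => by
        have : 0 ≤ l * (ancestors ω S n).card := by positivity
        change Real.exp _ ≤ 1
        rw [Real.exp_le_one_iff]
        linarith
    simpa using h
  have hsum : ∀ k ≤ n, u 0 + k * (b * (u 0 + p.survival ℓ S n - 1)) ≤ u k := by
    intro k hk
    induction k with
    | zero => simp
    | succ k ih =>
      have h1 := ih (by omega)
      have h2 := hstep k
      -- The mean weight increases and survival decreases in `k`, so one lower bound serves all `n`
      -- gains.
      have h3 : u 0 + p.survival ℓ S n - 1 ≤ max 0 (u k + p.survival ℓ S k - 1) := by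
        have h4 := hmono (Nat.zero_le k)
        have h5 := survival_antitone (p := p) ℓ S (show k ≤ n by omega)
        exact le_max_of_le_right (by linarith)
      have h6 := mul_le_mul_of_nonneg_left h3 hb0
      push_cast
      linarith
  have hfin := (hsum n le_rfl).trans hun
  have hnb : n * b = c ^ 2 / 8 := by rw [hb]; linear_combination (c ^ 2 / 8) * hll
  rw [← mul_assoc, hnb] at hfin
  have hc2 : 0 < c ^ 2 / 8 := by positivity
  have key : c ^ 2 / 8 * p.survival ℓ S n ≤ c ^ 2 / 8 * ((8 / c ^ 2 + 1) * (l * S.card)) := by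
    have e : c ^ 2 / 8 * ((8 / c ^ 2 + 1) * (l * S.card)) =
        l * S.card + c ^ 2 / 8 * (l * S.card) := by
      field_simp
    rw [e]
    have := mul_le_mul_of_nonneg_left hu0 hc2.le
    linarith
  have := le_of_mul_le_mul_left key hc2
  refine this.trans_eq ?_
  rw [hl_def]; ring

/-! ### From paths through the slit to survival, and the conclusion. -/

/-- A slit of width `m` contains at most `m + 1` nodes. -/
theorem _root_.DilutedLattice.exists_finset_slit {m : ℝ} (hm : 0 ≤ m) (x : Node) :
    ∃ S : Finset Node, (S : Set Node) = slit m x ∧ (∀ y ∈ S, y.1.1 = x.1.1) ∧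
      (S.card : ℝ) ≤ m + 1 := by
  set A : Finset ℤ := Finset.Icc ⌈(x.1.2 : ℝ) - m / 2⌉ ⌊(x.1.2 : ℝ) + m / 2⌋ with hA
  have hinj : Set.InjOn (fun y : Node => y.1.2) (slit m x) := fun y hy z hz h =>
    Subtype.ext (Prod.ext (hy.1.trans hz.1.symm) h)
  have hmaps : Set.MapsTo (fun y : Node => y.1.2) (slit m x) A := fun y hy => by
    simp only [hA, Finset.coe_Icc, Set.mem_Icc]
    exact ⟨Int.ceil_le.2 hy.2.1, Int.le_floor.2 hy.2.2⟩
  have hfin : (slit m x).Finite := Set.Finite.of_injOn hmaps hinj A.finite_toSet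
  refine ⟨hfin.toFinset, by simp, fun y hy => (hfin.mem_toFinset.1 hy).1, ?_⟩
  have hcard : hfin.toFinset.card ≤ A.card :=
    Finset.card_le_card_of_injOn (fun y : Node => y.1.2) (fun y hy => hmaps (by simpa using hy))
      (fun y hy z hz h => hinj (by simpa using hy) (by simpa using hz) h)
  refine (Nat.cast_le.2 hcard).trans ?_
  rw [hA, Int.card_Icc]
  have h1 := Int.le_ceil ((x.1.2 : ℝ) - m / 2)
  have h2 := Int.floor_le ((x.1.2 : ℝ) + m / 2)
  rw [← Int.cast_natCast, Int.toNat_eq_max, Int.cast_max]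
  push_cast
  exact max_le (by linarith) (by linarith)

theorem _root_.DilutedLattice.ancestors_nonempty_of_path {ω : Config}
    (hω : ∀ y, {x | Selects ω x y}.Finite) {m : ℝ} {x : Node} {S : Finset Node}
    (hS : (S : Set Node) = slit m x) {n : ℕ} {γ : ℕ → Node}
    (hγ : IsPathThroughSlit ω m x (n + 1) γ) : (ancestors ω S n).Nonempty := by
  have hpre : ∀ T : Finset Node, (preds ω T).Finite := fun T => by
    have : preds ω T = ⋃ y ∈ T, {x | Selects ω x y} := by ext; simp [preds]
    rw [this]
    exact T.finite_toSet.biUnion fun y _ => hω y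
  have hmem : ∀ i ≤ n, γ i ∈ ancestors ω S i := by
    intro i hi
    induction i with
    | zero =>
      have := hγ.2.2 (by omega)
      rw [← hS] at this
      exact this
    | succ i ih =>
      have he := hγ.2.1 i (by omega)
      simp only [ancestors, step, hpre, dite_true, Set.Finite.mem_toFinset]
      exact ⟨γ i, ih (by omega), he.2⟩
  exact ⟨γ n, hmem n le_rfl⟩

/-- Having at least `t > n` points means having at least `n + 1`, and a path cut down to `n + 1`
points makes `n` steps. -/
theorem tauTail_le_survival (hp : p.VerticallyHomogeneous) {m : ℝ} {x : Node} {S : Finset Node}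
    (hS : (S : Set Node) = slit m x) {t : ℝ} {n : ℕ} (hn : (n : ℝ) < t) :
    p.tauTail m x t ≤ ENNReal.ofReal (p.survival m S n) := by
  rw [survival, ofReal_measureReal, tauTail]
  refine measure_mono_ae ?_
  filter_upwards [ae_finite_setOf_selects m hp] with ω hω h
  have h' : ENNReal.ofReal t ≤ ((tau ω m x : ℕ∞) : ℝ≥0∞) := h
  by_contra hemp
  have htau : tau ω m x ≤ n := by
    refine iSup₂_le fun k ⟨γ, hγ⟩ => ?_
    by_contra hk
    have hk' : n + 1 ≤ k := by
      rw [Nat.cast_le] at hk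
      omega
    exact hemp (ancestors_nonempty_of_path hω hS (γ := γ)
      ⟨fun i hi => hγ.1 i (by omega), fun i hi => hγ.2.1 i (by omega), fun _ => hγ.2.2 (by omega)⟩)
  have h2 : ENNReal.ofReal t ≤ (n : ℝ≥0∞) := h'.trans (by exact_mod_cast htau)
  rw [← ENNReal.ofReal_natCast, ENNReal.ofReal_le_ofReal_iff (by positivity)] at h2
  linarith

end ThinningField

end DilutedLattice

theorem theorem2p2 (p : DilutedLattice.ThinningField) (hp : p.VerticallyHomogeneous) :
    ∃ C : ℝ, ∀ α : ℝ, 2 < α → ∀ ℓ : ℝ, 1 ≤ ℓ →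
      (⨆ x : DilutedLattice.Node, p.tauTail (ℓ ^ (1 / α)) x ℓ) <
        ENNReal.ofReal (C * ℓ ^ (1 / α - 1 / 2)) := by
  obtain ⟨c, hc0, hc⟩ := p.bounded_below
  set K : ℝ := 8 / c ^ 2 + 1 with hK
  have hK1 : 1 ≤ K := by
    have : 0 ≤ 8 / c ^ 2 := by positivity
    linarith
  -- The bound `4 * K` comes from `card S ≤ 2 * m` and `√n ≥ √ℓ / 2`; the extra 1 keeps the
  -- inequality strict after the supremum.
  refine ⟨4 * K + 1, fun α hα ℓ hℓ => ?_⟩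
  have hℓ0 : 0 < ℓ := by linarith
  set m : ℝ := ℓ ^ (1 / α) with hm
  have hm1 : 1 ≤ m := Real.one_le_rpow hℓ (by positivity)
  have hpow : ℓ ^ (1 / α - 1 / 2) = m / √ℓ := by
    rw [Real.rpow_sub hℓ0, Real.sqrt_eq_rpow]
  have hs0 : 0 < √ℓ := Real.sqrt_pos.2 hℓ0
  have hpos : 0 < m / √ℓ := by positivity
  rw [hpow]
  refine (iSup_le fun x => ?_).trans_lt ((ENNReal.ofReal_lt_ofReal_iff (by positivity)).2
    (show 4 * K * (m / √ℓ) < (4 * K + 1) * (m / √ℓ) by linarith))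
  -- For `ℓ < 2` the bound exceeds 1; this avoids `⌈ℓ⌉₊ - 1 = 0` at `ℓ = 1`.
  rcases lt_or_ge ℓ 2 with h2 | h2
  · refine (prob_le_one (μ := p.law m)).trans ?_
    rw [← ENNReal.ofReal_one]
    refine ENNReal.ofReal_le_ofReal ?_
    have h3 : √ℓ ≤ 2 := Real.sqrt_le_iff.2 ⟨by norm_num, by linarith⟩
    rw [← mul_div_assoc, le_div_iff₀ hs0]
    nlinarith
  · obtain ⟨S, hS, hSl, hScard⟩ := DilutedLattice.exists_finset_slit (m := m) (by linarith) x
    have hceil : 1 < ⌈ℓ⌉₊ := Nat.lt_ceil.2 (by push_cast; linarith)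
    have hn1 : ((⌈ℓ⌉₊ - 1 : ℕ) : ℝ) = ⌈ℓ⌉₊ - 1 := by
      rw [Nat.cast_sub hceil.le, Nat.cast_one]
    have hnlt : ((⌈ℓ⌉₊ - 1 : ℕ) : ℝ) < ℓ := by
      rw [hn1]; linarith [Nat.ceil_lt_add_one hℓ0.le]
    have hnge : ℓ / 4 ≤ ((⌈ℓ⌉₊ - 1 : ℕ) : ℝ) := by
      rw [hn1]; linarith [Nat.le_ceil ℓ]
    refine (DilutedLattice.ThinningField.tauTail_le_survival hp hS hnlt).trans
      (ENNReal.ofReal_le_ofReal ?_)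
    refine (DilutedLattice.ThinningField.survival_le m hp hc hc0 hSl (by omega)).trans ?_
    have hsn : √ℓ / 2 ≤ √((⌈ℓ⌉₊ - 1 : ℕ) : ℝ) := by
      refine Real.le_sqrt_of_sq_le ?_
      rw [div_pow, Real.sq_sqrt hℓ0.le]
      linarith
    calc K * S.card / √((⌈ℓ⌉₊ - 1 : ℕ) : ℝ) ≤ K * (2 * m) / (√ℓ / 2) := by
          gcongr
          linarith
      _ = 4 * K * (m / √ℓ) := by field_simp; ring
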